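/- Fix relational vocabularies $\sigma$ and nonempty $\sigma$-structures. Monadic second-order logic $\mathrm{MSO}$ extends first-order logic by quantification over subsets of the domain; weak monadic second-order logic $\mathrm{WMSO}$ has the same syntax, but its set quantifiers range over finite subsets of the domain only. The fragments $\forall\mathrm{MSO}$ and $\forall\mathrm{WMSO}$ consist of the sentences $\forall X_1\cdots\forall X_k\,\varphi$ with $k\ge 0$ and $\varphi$ free of set quantifiers, interpreted as in $\mathrm{MSO}$ and in $\mathrm{WMSO}$, respectively. For two such logics write $\mathcal{L}\le\mathcal{L}'$ if, for every relational vocabulary $\sigma$, each class of $\sigma$-structures definable by a $\sigma$-sentence of $\mathcal{L}$ is also definable by a $\sigma$-sentence of $\mathcal{L}'$. **Proposition.** $\forall\mathrm{WMSO}\not\le\mathrm{MSO}$ and $\forall\mathrm{MSO}\not\le\mathrm{WMSO}$. Moreover: 1. For every relational vocabulary $\sigma$, the class of infinite $\sigma$-structures is definable by a sentence of $\forall\mathrm{WMSO}$, but not by any sentence of $\mathrm{MSO}$. 2. There is a $\forall\mathrm{MSO}$-sentence $\varphi$ of the vocabulary $\{<\}$ which is true in a nonempty linear order $(M,<)$ if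 and only if every nonempty subset of $M$ that is bounded from above has a least upper bound; in particular $(\mathbb{R},<)\models\varphi$ and $(\mathbb{Q},<)\not\models\varphi$. On the other hand, $(\mathbb{R},<)$ and $(\mathbb{Q},<)$ satisfy exactly the same $\mathrm{WMSO}$-sentences of the vocabulary $\{<\}$. -/

import Mathlib

universe u

namespace MonadicSO

/-- Monadic second-order formulas over the vocabulary `L`, with `m` free set variables (indexed by
`Fin m`) and `n` free element variables (indexed by `Fin n`), in de Bruijn style: a quantifier
binds the variable with index `0` of its body. Negation, conjunction and the existential
quantifiers are the usual classical abbreviations. -/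
inductive MSOFormula (L : FirstOrder.Language.{0, 0}) : ℕ → ℕ → Type
  | falsum {m n : ℕ} : MSOFormula L m n
  | equal {m n : ℕ} (s t : L.Term (Fin n)) : MSOFormula L m n
  | rel {m n k : ℕ} (R : L.Relations k) (ts : Fin k → L.Term (Fin n)) : MSOFormula L m n
  | mem {m n : ℕ} (X : Fin m) (t : L.Term (Fin n)) : MSOFormula L m n
  | imp {m n : ℕ} (φ ψ : MSOFormula L m n) : MSOFormula L m n
  | all {m n : ℕ} (φ : MSOFormula L m (n + 1)) : MSOFormula L m n
  | allSet {m n : ℕ} (φ : MSOFormula L (m + 1) n) : MSOFormula L m n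

/-- Sentences: no free set variables and no free element variables. -/
abbrev MSOSentence (L : FirstOrder.Language.{0, 0}) : Type := MSOFormula L 0 0

/-- The two readings of the set quantifiers: all subsets, or only finite subsets. -/
inductive SetSemantics : Type
  | full
  | weak

/-- The subsets of the domain over which the set quantifiers range. -/
def SetSemantics.Admits {M : Type u} : SetSemantics → Set M → Prop
  | .full, _ => True
  | .weak, X => X.Finite

namespace MSOFormula

variable {L : FirstOrder.Language.{0, 0}}

/-- Negation. -/
def neg {m n : ℕ} (φ : MSOFormula L m n) : MSOFormula L m n := imp φ falsum

/-- Existential quantification over elements. -/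
def ex {m n : ℕ} (φ : MSOFormula L m (n + 1)) : MSOFormula L m n := neg (all (neg φ))

/-- Tarskian satisfaction, under an assignment `V` of the free set variables and an assignment `v`
of the free element variables. -/
def Realize (s : SetSemantics) {M : Type u} [L.Structure M] :
    {m n : ℕ} → MSOFormula L m n → (Fin m → Set M) → (Fin n → M) → Prop
  | _, _, falsum, _, _ => False
  | _, _, equal t₁ t₂, _, v => t₁.realize v = t₂.realize v
  | _, _, rel R ts, _, v => FirstOrder.Language.Structure.RelMap R (fun i => (ts i).realize v)
  | _, _, mem X t, V, v => t.realize v ∈ V X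
  | _, _, imp φ ψ, V, v => Realize s φ V v → Realize s ψ V v
  | _, n, all φ, V, v =>
      ∀ a : M, Realize s φ V (Fin.cons (α := fun _ : Fin (n + 1) => M) a v)
  | m, _, allSet φ, V, v =>
      ∀ X : Set M, s.Admits X →
        Realize s φ (Fin.cons (α := fun _ : Fin (m + 1) => Set M) X V) v

/-- A formula without set quantifiers (free set variables may occur, as unary predicates). -/
def IsFirstOrder : {m n : ℕ} → MSOFormula L m n → Prop
  | _, _, falsum => True
  | _, _, equal _ _ => True
  | _, _, rel _ _ => True
  | _, _, mem _ _ => True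
  | _, _, imp φ ψ => IsFirstOrder φ ∧ IsFirstOrder ψ
  | _, _, all φ => IsFirstOrder φ
  | _, _, allSet _ => False

/-- Universal formulas: a (possibly empty) block of universal set quantifiers in front of a formula
without set quantifiers. -/
inductive IsUniversal : {m n : ℕ} → MSOFormula L m n → Prop
  | ofFirstOrder {m n : ℕ} {φ : MSOFormula L m n} : φ.IsFirstOrder → IsUniversal φ
  | allSet {m n : ℕ} {φ : MSOFormula L (m + 1) n} : IsUniversal φ → IsUniversal (allSet φ)

end MSOFormula

/-- The sentence `φ` is true in the structure `M`. -/
def Models (s : SetSemantics) {L : FirstOrder.Language.{0, 0}} (M : Type u) [L.Structure M]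
    (φ : MSOSentence L) : Prop :=
  φ.Realize s (M := M) Fin.elim0 Fin.elim0

/-- A fragment of (weak) monadic second-order logic: a reading of the set quantifiers, and for each
vocabulary a set of sentences. -/
structure MonadicLogic where
  sem : SetSemantics
  sentences : ∀ L : FirstOrder.Language.{0, 0}, Set (MSOSentence L)

/-- Monadic second-order logic. -/
def MSO : MonadicLogic := ⟨.full, fun _ => Set.univ⟩

/-- Weak monadic second-order logic. -/
def WMSO : MonadicLogic := ⟨.weak, fun _ => Set.univ⟩

/-- Universal monadic second-order logic. -/
def univMSO : MonadicLogic := ⟨.full, fun _ => {φ | φ.IsUniversal}⟩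

/-- Weak universal monadic second-order logic. -/
def univWMSO : MonadicLogic := ⟨.weak, fun _ => {φ | φ.IsUniversal}⟩

/-- Classes of `L`-structures. Only nonempty structures are ever considered. -/
abbrev StructureClass (L : FirstOrder.Language.{0, 0}) : Type (u + 1) :=
  ∀ (M : Type u) [L.Structure M], Prop

/-- The class `K` of structures is defined by some sentence of the logic. -/
def MonadicLogic.Defines (𝓛 : MonadicLogic) {L : FirstOrder.Language.{0, 0}}
    (K : StructureClass.{u} L) : Prop :=
  ∃ φ ∈ 𝓛.sentences L, ∀ (M : Type u) [Nonempty M] [L.Structure M],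
    K M ↔ Models 𝓛.sem M φ

/-- `𝓛 ≤ 𝓛'`: for every relational vocabulary, each class of structures that is definable in `𝓛` is
definable in `𝓛'`. -/
def MonadicLogic.Le (𝓛 𝓛' : MonadicLogic) : Prop :=
  ∀ (L : FirstOrder.Language.{0, 0}) [L.IsRelational] (K : StructureClass.{u} L),
    𝓛.Defines K → 𝓛'.Defines K

/-- The class of infinite `L`-structures. -/
def infiniteClass (L : FirstOrder.Language.{0, 0}) : StructureClass.{u} L := fun M _ => Infinite M

/-- The single, binary, relation symbol `<`. -/
inductive LtRel : ℕ → Type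
  | lt : LtRel 2

/-- The vocabulary `{<}`. -/
def ltLanguage : FirstOrder.Language.{0, 0} := ⟨fun _ => Empty, LtRel⟩

/-- `(M, <)` as a structure of the vocabulary `{<}`. -/
instance ltStructure (M : Type u) [LT M] : ltLanguage.Structure M where
  funMap := fun f => nomatch f
  RelMap := fun {n} (R : LtRel n) =>
    match n, R with
    | _, .lt => fun x => x 0 < x 1

end MonadicSO

open MonadicSO

/-! Both inexpressibility results are Ehrenfeucht–Fraïssé arguments, resting on
`BackAndForth.realize_iff`: positions from which `r` more rounds can be played agree on formulas of
rank at most `r`.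

For infinity, all relations are interpreted as empty, so a position is described by the sizes of the
cells cut out by the chosen sets and points. Counting these sizes up to `2 ^ (r + 1)` suffices,
because a set move splits every cell in two and costs half the threshold
(`exists_subset_min_encard_eq`). Hence a large enough finite structure and an infinite one agree on
any given MSO-sentence, whereas the weak reading expresses infinity by saying that every finite set
misses a point.

For completeness of the order, Cantor's argument extends finite partial isomorphisms between dense
orders without endpoints. A finite set is answered point by point, so weak set quantifiers add no
separating power, and ℝ and ℚ are WMSO-equivalent. The least upper bound property separates them
under the full reading, by the cut at √2. -/

namespace MonadicSO

open FirstOrder Language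

/-! ### Quantifier rank and back-and-forth systems -/

namespace MSOFormula

variable {L : FirstOrder.Language.{0, 0}}

/-- The quantifier rank of a formula. -/
def rank : {m n : ℕ} → MSOFormula L m n → ℕ
  | _, _, falsum => 0
  | _, _, equal _ _ => 0
  | _, _, rel _ _ => 0
  | _, _, mem _ _ => 0
  | _, _, imp φ ψ => max (rank φ) (rank ψ)
  | _, _, all φ => rank φ + 1
  | _, _, allSet φ => rank φ + 1

theorem realize_ex {s : SetSemantics} {M : Type*} [L.Structure M] {m n : ℕ}
    {φ : MSOFormula L m (n + 1)} {V : Fin m → Set M} {v : Fin n → M} :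
    φ.ex.Realize s V v ↔
      ∃ a : M, φ.Realize s V (Fin.cons (α := fun _ : Fin (n + 1) => M) a v) :=
  not_forall_not

end MSOFormula

/-- Over a relational language every term is a variable. -/
theorem exists_eq_var_of_isRelational {L : FirstOrder.Language.{0, 0}} [L.IsRelational]
    {α : Type} (t : L.Term α) : ∃ i, t = Term.var i := by
  cases t with
  | var i => exact ⟨i, rfl⟩
  | func f _ => exact isEmptyElim f

/-- A back-and-forth system, graded by the number of remaining rounds, for monadic second-order
formulas: `I r` relates the positions from which `r` further rounds can be played. -/
structure BackAndForth (s : SetSemantics) (L : FirstOrder.Language.{0, 0}) (M : Type*) (N : Type*)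
    [L.Structure M] [L.Structure N]
    (I : ℕ → ∀ m n : ℕ, (Fin m → Set M) → (Fin n → M) → (Fin m → Set N) → (Fin n → N) → Prop) :
    Prop where
  eq_iff : ∀ {r m n V v W w}, I r m n V v W w → ∀ i j, v i = v j ↔ w i = w j
  mem_iff : ∀ {r m n V v W w}, I r m n V v W w → ∀ k i, v i ∈ V k ↔ w i ∈ W k
  rel_iff : ∀ {r m n V v W w}, I r m n V v W w → ∀ {k} (R : L.Relations k) (f : Fin k → Fin n),
    Structure.RelMap R (fun i => v (f i)) ↔ Structure.RelMap R (fun i => w (f i))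
  forth : ∀ {r m n V v W w}, I (r + 1) m n V v W w → ∀ a : M, ∃ b : N,
    I r m (n + 1) V (Fin.cons (α := fun _ : Fin (n + 1) => M) a v)
      W (Fin.cons (α := fun _ : Fin (n + 1) => N) b w)
  back : ∀ {r m n V v W w}, I (r + 1) m n V v W w → ∀ b : N, ∃ a : M,
    I r m (n + 1) V (Fin.cons (α := fun _ : Fin (n + 1) => M) a v)
      W (Fin.cons (α := fun _ : Fin (n + 1) => N) b w)
  forthSet : ∀ {r m n V v W w}, I (r + 1) m n V v W w → ∀ X : Set M, s.Admits X →
    ∃ Y : Set N, s.Admits Y ∧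
    I r (m + 1) n (Fin.cons (α := fun _ : Fin (m + 1) => Set M) X V) v
      (Fin.cons (α := fun _ : Fin (m + 1) => Set N) Y W) w
  backSet : ∀ {r m n V v W w}, I (r + 1) m n V v W w → ∀ Y : Set N, s.Admits Y →
    ∃ X : Set M, s.Admits X ∧
    I r (m + 1) n (Fin.cons (α := fun _ : Fin (m + 1) => Set M) X V) v
      (Fin.cons (α := fun _ : Fin (m + 1) => Set N) Y W) w

/-- Related positions satisfy the same formulas of small rank. -/
theorem BackAndForth.realize_iff {s : SetSemantics} {L : FirstOrder.Language.{0, 0}}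
    [L.IsRelational] {M : Type*} {N : Type*} [L.Structure M] [L.Structure N]
    {I : ℕ → ∀ m n : ℕ, (Fin m → Set M) → (Fin n → M) → (Fin m → Set N) → (Fin n → N) → Prop}
    (h : BackAndForth s L M N I) {m n : ℕ} (φ : MSOFormula L m n) :
    ∀ {r V v W w}, φ.rank ≤ r → I r m n V v W w → (φ.Realize s V v ↔ φ.Realize s W w) := by
  induction φ with
  | falsum => intros; exact Iff.rfl
  | equal t₁ t₂ =>
    intro r V v W w _ hI
    obtain ⟨i, rfl⟩ := exists_eq_var_of_isRelational t₁
    obtain ⟨j, rfl⟩ := exists_eq_var_of_isRelational t₂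
    exact h.eq_iff hI i j
  | rel R ts =>
    intro r V v W w _ hI
    choose f hf using fun i => exists_eq_var_of_isRelational (ts i)
    obtain rfl : ts = fun i => Term.var (f i) := funext hf
    exact h.rel_iff hI R f
  | mem X t =>
    intro r V v W w _ hI
    obtain ⟨i, rfl⟩ := exists_eq_var_of_isRelational t
    exact h.mem_iff hI X i
  | imp φ ψ ihφ ihψ =>
    intro r V v W w hr hI
    exact imp_congr (ihφ ((le_max_left _ _).trans hr) hI) (ihψ ((le_max_right _ _).trans hr) hI)
  | all φ ih =>
    intro r V v W w hr hI
    obtain ⟨r, rfl⟩ := Nat.exists_eq_add_of_le' ((Nat.le_add_left 1 _).trans hr)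
    have hr' : φ.rank ≤ r := Nat.le_of_succ_le_succ hr
    constructor
    · intro hM b
      obtain ⟨a, ha⟩ := h.back hI b
      exact (ih hr' ha).1 (hM a)
    · intro hN a
      obtain ⟨b, hb⟩ := h.forth hI a
      exact (ih hr' hb).2 (hN b)
  | allSet φ ih =>
    intro r V v W w hr hI
    obtain ⟨r, rfl⟩ := Nat.exists_eq_add_of_le' ((Nat.le_add_left 1 _).trans hr)
    have hr' : φ.rank ≤ r := Nat.le_of_succ_le_succ hr
    constructor
    · intro hM Y hY
      obtain ⟨X, hX, hI'⟩ := h.backSet hI Y hY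
      exact (ih hr' hI').1 (hM X hX)
    · intro hN X hX
      obtain ⟨Y, hY, hI'⟩ := h.forthSet hI X hX
      exact (ih hr' hI').2 (hN Y hY)

/-! ### Cardinalities up to a threshold -/

/-- A part with fewer than `t` elements can be copied at its exact size. Removing equally many,
fewer than `t`, elements from two sets that agree up to `2 * t` leaves sets that agree up to `t`. -/
theorem exists_subset_min_encard_eq_of_lt {M : Type*} {N : Type*} {A : Set M} {B : Set N} {t : ℕ}
    (h : min A.encard ((2 * t : ℕ) : ℕ∞) = min B.encard ((2 * t : ℕ) : ℕ∞))
    {X : Set M} (hX : X ⊆ A) (hx : X.encard < t) :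
    ∃ Y ⊆ B, min X.encard t = min Y.encard t ∧
      min (A \ X).encard t = min (B \ Y).encard t := by
  have hA := Set.encard_sdiff_add_encard_of_subset hX
  rw [← hA] at h
  generalize X.encard = x at *
  generalize (A \ X).encard = x' at *
  obtain ⟨Y, hYB, hY⟩ := Set.exists_subset_encard_eq (s := B) (k := x) (by
    generalize B.encard = b at *
    clear hA
    rcases le_total (x' + x) ((2 * t : ℕ) : ℕ∞) with h1 | h1 <;>
    rcases le_total b ((2 * t : ℕ) : ℕ∞) with h2 | h2 <;>
    simp only [h1, h2, min_eq_left, min_eq_right] at h <;> enat_to_nat <;> omega)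
  have hB := Set.encard_sdiff_add_encard_of_subset hYB
  refine ⟨Y, hYB, by rw [hY], ?_⟩
  rw [← hB, hY] at h
  generalize (B \ Y).encard = z at *
  clear hA hB hY
  rcases le_total (x' + x) ((2 * t : ℕ) : ℕ∞) with h1 | h1 <;>
  rcases le_total (z + x) ((2 * t : ℕ) : ℕ∞) with h2 | h2 <;>
  simp only [h1, h2, min_eq_left, min_eq_right] at h <;>
  rcases le_total x' (t : ℕ∞) with h3 | h3 <;>
  rcases le_total z (t : ℕ∞) with h4 | h4 <;>
  simp only [h3, h4, min_eq_left, min_eq_right] <;> enat_to_nat <;> omega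

/-- Splitting of a set into two parts can be imitated in a set of the same cardinality up to
twice the threshold. -/
theorem exists_subset_min_encard_eq {M : Type*} {N : Type*} {A : Set M} {B : Set N} {t : ℕ}
    (h : min A.encard ((2 * t : ℕ) : ℕ∞) = min B.encard ((2 * t : ℕ) : ℕ∞))
    {X : Set M} (hX : X ⊆ A) :
    ∃ Y ⊆ B, min X.encard t = min Y.encard t ∧
      min (A \ X).encard t = min (B \ Y).encard t := by
  -- If `X` or its complement in `A` is small, copy the small part exactly. If both are large, `B`
  -- has at least `2 * t` elements, and any `Y` of size `t` leaves at least `t` behind.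
  rcases lt_or_ge X.encard t with hx | hx
  · exact exists_subset_min_encard_eq_of_lt h hX hx
  rcases lt_or_ge (A \ X).encard t with hx' | hx'
  · obtain ⟨Y, hYB, h1, h2⟩ := exists_subset_min_encard_eq_of_lt h Set.sdiff_subset hx'
    rw [Set.sdiff_sdiff_cancel_left hX] at h2
    exact ⟨B \ Y, Set.sdiff_subset, h2, by rwa [Set.sdiff_sdiff_cancel_left hYB]⟩
  have hA : ((2 * t : ℕ) : ℕ∞) ≤ A.encard := by
    rw [← Set.encard_sdiff_add_encard_of_subset hX, two_mul, Nat.cast_add]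
    exact add_le_add hx' hx
  rw [min_eq_right hA, eq_comm, min_eq_right_iff, two_mul, Nat.cast_add] at h
  obtain ⟨Y, hYB, hY⟩ := Set.exists_subset_encard_eq (le_self_add.trans h)
  have hB := Set.encard_sdiff_add_encard_of_subset hYB
  rw [← hB, hY] at h
  refine ⟨Y, hYB, by rw [hY, min_eq_right hx, min_self], ?_⟩
  rw [min_eq_right hx', min_eq_right]
  exact (ENat.add_le_add_iff_right (ENat.natCast_ne_top t)).1 h

/-! ### The game on structures without relations -/

/-- The elements of `M` that have a prescribed position relative to the sets `V` and the points
`v`. -/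
def cell {M : Type*} {m n : ℕ} (V : Fin m → Set M) (v : Fin n → M) (c : Fin m → Prop)
    (d : Fin n → Prop) : Set M :=
  {x | (∀ k, x ∈ V k ↔ c k) ∧ ∀ i, v i = x ↔ d i}

theorem mem_cell_self {M : Type*} {m n : ℕ} (V : Fin m → Set M) (v : Fin n → M) (x : M) :
    x ∈ cell V v (fun k => x ∈ V k) (fun i => v i = x) :=
  ⟨fun _ => Iff.rfl, fun _ => Iff.rfl⟩

theorem eq_of_mem_cell {M : Type*} {m n : ℕ} {V : Fin m → Set M} {v : Fin n → M} {x : M}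
    {c : Fin m → Prop} {d : Fin n → Prop} (h : x ∈ cell V v c d) :
    c = (fun k => x ∈ V k) ∧ d = fun i => v i = x :=
  ⟨funext fun k => propext (h.1 k).symm, funext fun i => propext (h.2 i).symm⟩

theorem cell_eq_univ {M : Type*} (V : Fin 0 → Set M) (v : Fin 0 → M) (c : Fin 0 → Prop)
    (d : Fin 0 → Prop) : cell V v c d = Set.univ :=
  Set.eq_univ_of_forall fun _ => ⟨fun k => k.elim0, fun i => i.elim0⟩

theorem cell_cons_set {M : Type*} {m n : ℕ} (V : Fin m → Set M) (v : Fin n → M) (X : Set M)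
    (c : Fin (m + 1) → Prop) (d : Fin n → Prop) :
    cell (Fin.cons (α := fun _ : Fin (m + 1) => Set M) X V) v c d =
      {x ∈ cell V v (fun k => c k.succ) d | x ∈ X ↔ c 0} := by
  ext x
  simp only [cell, Set.mem_ofPred_eq, Fin.forall_fin_succ, Fin.cons_zero, Fin.cons_succ]
  tauto

/-- A new point refines the cells exactly as its singleton would, so `exists_split` can serve point
moves as well as set moves. -/
theorem cell_cons_point {M : Type*} {m n : ℕ} (V : Fin m → Set M) (v : Fin n → M) (a : M)
    (c : Fin m → Prop) (d : Fin (n + 1) → Prop) :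
    cell V (Fin.cons (α := fun _ : Fin (n + 1) => M) a v) c d =
      {x ∈ cell V v c (fun i => d i.succ) | x ∈ ({a} : Set M) ↔ d 0} := by
  ext x
  simp only [cell, Set.mem_ofPred_eq, Fin.forall_fin_succ, Fin.cons_zero, Fin.cons_succ,
    Set.mem_singleton_iff, eq_comm (a := x)]
  tauto

/-- Corresponding cells have the same cardinality up to the threshold `2 ^ (r + 1)`. -/
def CellEquiv (M : Type*) (N : Type*) (r m n : ℕ) (V : Fin m → Set M) (v : Fin n → M)
    (W : Fin m → Set N) (w : Fin n → N) : Prop :=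
  ∀ c d, min (cell V v c d).encard ((2 ^ (r + 1) : ℕ) : ℕ∞) =
    min (cell W w c d).encard ((2 ^ (r + 1) : ℕ) : ℕ∞)

namespace CellEquiv

variable {M : Type*} {N : Type*} {r m n : ℕ} {V : Fin m → Set M} {v : Fin n → M}
  {W : Fin m → Set N} {w : Fin n → N}

theorem symm (h : CellEquiv M N r m n V v W w) : CellEquiv N M r m n W w V v :=
  fun c d => (h c d).symm

theorem nonempty_of_nonempty (h : CellEquiv M N r m n V v W w) {c d}
    (hc : (cell V v c d).Nonempty) : (cell W w c d).Nonempty := by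
  have h1 : (1 : ℕ∞) ≤ ((2 ^ (r + 1) : ℕ) : ℕ∞) := by exact_mod_cast Nat.one_le_two_pow
  have h2 := le_min (Set.one_le_encard_iff_nonempty.2 hc) h1
  rw [h c d] at h2
  exact Set.one_le_encard_iff_nonempty.1 (h2.trans (min_le_left _ _))

/-- The cell of `v i` is inhabited, so its counterpart is too, and the equality pattern forces any
inhabitant to be `w i`. This settles the atomic formulas. -/
theorem mem_cell (h : CellEquiv M N r m n V v W w) (i : Fin n) :
    w i ∈ cell W w (fun k => v i ∈ V k) (fun j => v j = v i) := by
  obtain ⟨y, hy⟩ := h.nonempty_of_nonempty ⟨_, mem_cell_self V v (v i)⟩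
  obtain rfl : w i = y := (hy.2 i).2 rfl
  exact hy

theorem exists_split (h : CellEquiv M N (r + 1) m n V v W w) (X : Set M) :
    ∃ Y : Set N, ∀ (p : Prop) c d,
      min {x ∈ cell V v c d | x ∈ X ↔ p}.encard ((2 ^ (r + 1) : ℕ) : ℕ∞) =
        min {y ∈ cell W w c d | y ∈ Y ↔ p}.encard ((2 ^ (r + 1) : ℕ) : ℕ∞) := by
  have key : ∀ c d, ∃ Y ⊆ cell W w c d, _ ∧ _ := fun c d =>
    exists_subset_min_encard_eq (t := 2 ^ (r + 1)) ((pow_succ' 2 (r + 1)) ▸ h c d)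
      (Set.inter_subset_left : cell V v c d ∩ X ⊆ cell V v c d)
  choose Y hY h1 h2 using key
  -- The cells partition `N`, so the answers chosen cell by cell glue to one set: each `y` consults
  -- the answer for its own cell.
  let Z : Set N := {y | y ∈ Y (fun k => y ∈ W k) (fun i => w i = y)}
  have hZ : ∀ c d, cell W w c d ∩ Z = Y c d := by
    intro c d
    ext y
    constructor
    · rintro ⟨hy, hyZ⟩
      obtain ⟨rfl, rfl⟩ := eq_of_mem_cell hy
      exact hyZ
    · intro hy
      have hy' := hY c d hy
      refine ⟨hy', ?_⟩
      obtain ⟨rfl, rfl⟩ := eq_of_mem_cell hy'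
      exact hy
  refine ⟨Z, fun p c d => ?_⟩
  by_cases hp : p
  · simp only [hp, iff_true]
    have := h1 c d
    rw [← hZ] at this
    exact this
  · simp only [hp, iff_false]
    have := h2 c d
    rw [← hZ, Set.sdiff_self_inter, Set.sdiff_self_inter] at this
    exact this

theorem forthSet (h : CellEquiv M N (r + 1) m n V v W w) (X : Set M) :
    ∃ Y : Set N, CellEquiv M N r (m + 1) n
      (Fin.cons (α := fun _ : Fin (m + 1) => Set M) X V) v
      (Fin.cons (α := fun _ : Fin (m + 1) => Set N) Y W) w := by
  obtain ⟨Y, hY⟩ := h.exists_split X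
  refine ⟨Y, fun c d => ?_⟩
  rw [cell_cons_set, cell_cons_set]
  exact hY _ _ _

/-- A point move is the set move `{a}`. The remaining threshold is at least 2, so it distinguishes
one element from more and the answer is again a singleton; this is why the exponent is `r + 1`
rather than `r`. -/
theorem forth (h : CellEquiv M N (r + 1) m n V v W w) (a : M) :
    ∃ b : N, CellEquiv M N r m (n + 1)
      V (Fin.cons (α := fun _ : Fin (n + 1) => M) a v)
      W (Fin.cons (α := fun _ : Fin (n + 1) => N) b w) := by
  obtain ⟨Y, hY⟩ := h.exists_split {a}
  have h2 : (2 : ℕ∞) ≤ ((2 ^ (r + 1) : ℕ) : ℕ∞) := by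
    exact_mod_cast Nat.le_self_pow (Nat.succ_ne_zero r) 2
  have h1 : (1 : ℕ∞) < ((2 ^ (r + 1) : ℕ) : ℕ∞) := lt_of_lt_of_le (by norm_num) h2
  have ha := hY True (fun k => a ∈ V k) (fun i => v i = a)
  have haX : {x ∈ cell V v (fun k => a ∈ V k) (fun i => v i = a) | x ∈ ({a} : Set M) ↔ True} =
      {a} := by
    ext x
    simp only [iff_true, Set.mem_singleton_iff, Set.mem_ofPred_eq, and_iff_right_iff_imp]
    rintro rfl
    exact mem_cell_self V v x
  rw [haX, Set.encard_singleton, min_eq_left h1.le] at ha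
  obtain ⟨b, hb⟩ : ∃ b, {y ∈ cell W w (fun k => a ∈ V k) (fun i => v i = a) | y ∈ Y ↔ True} =
      {b} := by
    rw [← Set.encard_eq_one]
    rcases min_choice {y ∈ cell W w (fun k => a ∈ V k) (fun i => v i = a) | y ∈ Y ↔ True}.encard
      ((2 ^ (r + 1) : ℕ) : ℕ∞) with h3 | h3
    · exact (ha.trans h3).symm
    · exact absurd (ha.trans h3) h1.ne
  -- An element of `Y` makes its part of a cell nonempty, hence also the corresponding part on the
  -- other side. That part can only contain `a`, so the cell is the one of `a`, where `Y` has the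
  -- single element `b`.
  have hYb : Y = {b} := by
    ext y
    constructor
    · intro hy
      have hne : {x ∈ cell V v (fun k => y ∈ W k) (fun i => w i = y) |
          x ∈ ({a} : Set M) ↔ True}.Nonempty := by
        by_contra hne
        rw [Set.not_nonempty_iff_eq_empty] at hne
        have h3 := hY True (fun k => y ∈ W k) (fun i => w i = y)
        rw [hne, Set.encard_empty, min_eq_left zero_le, eq_comm] at h3
        rcases min_choice {x ∈ cell W w (fun k => y ∈ W k) (fun i => w i = y) |
          x ∈ Y ↔ True}.encard ((2 ^ (r + 1) : ℕ) : ℕ∞) with h4 | h4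
        · rw [h4, Set.encard_eq_zero] at h3
          exact (Set.eq_empty_iff_forall_notMem.1 h3 y) ⟨mem_cell_self W w y, by simpa using hy⟩
        · rw [h4] at h3
          exact absurd h3 (zero_lt_one.trans h1).ne'
      obtain ⟨x, hx, hxa⟩ := hne
      obtain rfl : x = a := hxa.2 trivial
      obtain ⟨h5, h6⟩ := eq_of_mem_cell hx
      rw [← hb, ← h5, ← h6]
      exact ⟨mem_cell_self W w y, by simpa using hy⟩
    · rintro rfl
      have : y ∈ ({y} : Set N) := rfl
      rw [← hb] at this
      exact this.2.2 trivial
  subst hYb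
  refine ⟨b, fun c d => ?_⟩
  rw [cell_cons_point, cell_cons_point]
  exact hY _ _ _

end CellEquiv

/-- The structure all of whose relations are empty. -/
@[reducible] def emptyStructure (L : FirstOrder.Language.{0, 0}) [L.IsRelational] (M : Type*) :
    L.Structure M where
  funMap f := isEmptyElim f
  RelMap _ _ := False

theorem backAndForth_cellEquiv (L : FirstOrder.Language.{0, 0}) [L.IsRelational]
    (M : Type*) (N : Type*) :
    letI := emptyStructure L M
    letI := emptyStructure L N
    BackAndForth .full L M N (CellEquiv M N) :=
  let _ := emptyStructure L M
  let _ := emptyStructure L N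
  { eq_iff := fun h i j => ((h.mem_cell j).2 i).symm
    mem_iff := fun h k i => ((h.mem_cell i).1 k).symm
    rel_iff := fun _ _ _ _ => Iff.rfl
    forth := fun h a => h.forth a
    back := fun h b => (h.symm.forth b).imp fun _ h => h.symm
    forthSet := fun h X _ => (h.forthSet X).imp fun _ h => ⟨trivial, h⟩
    backSet := fun h Y _ => (h.symm.forthSet Y).imp fun _ h => ⟨trivial, h.symm⟩ }

/-- Without relations, monadic second-order logic cannot tell large structures apart. -/
theorem models_full_emptyStructure_iff {L : FirstOrder.Language.{0, 0}} [L.IsRelational]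
    (φ : MSOSentence L) (M : Type*) (N : Type*)
    (hM : ((2 ^ (φ.rank + 1) : ℕ) : ℕ∞) ≤ ENat.card M)
    (hN : ((2 ^ (φ.rank + 1) : ℕ) : ℕ∞) ≤ ENat.card N) :
    letI := emptyStructure L M
    letI := emptyStructure L N
    Models .full M φ ↔ Models .full N φ := by
  let _ := emptyStructure L M
  let _ := emptyStructure L N
  refine (backAndForth_cellEquiv L M N).realize_iff φ le_rfl fun c d => ?_
  -- At the start, with no sets or points chosen, the only cell is the whole domain.
  rw [cell_eq_univ, cell_eq_univ, Set.encard_univ, Set.encard_univ, min_eq_right hM, min_eq_right hN]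

/-! ### Infinity -/

theorem not_defines_mso_infiniteClass (L : FirstOrder.Language.{0, 0}) [L.IsRelational] :
    ¬ MSO.Defines (infiniteClass.{u} L) := by
  rintro ⟨φ, -, h⟩
  let F := ULift.{u} (Fin (2 ^ (φ.rank + 1)))
  let I := ULift.{u} ℕ
  let _ := emptyStructure L F
  let _ := emptyStructure L I
  have hF : ¬ Infinite F := not_infinite_iff_finite.2 inferInstance
  have hI : Infinite I := inferInstance
  have : Nonempty F := ⟨⟨⟨0, by positivity⟩⟩⟩
  refine hF ((h F).2 ((models_full_emptyStructure_iff φ F I ?_ ?_).2 ((h I).1 hI)))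
  · simp [F]
  · simp [I]

/-- Some element is missing from every set. -/
def infinityFormula (L : FirstOrder.Language.{0, 0}) : MSOSentence L :=
  .allSet (.ex (.neg (.mem 0 (Term.var 0))))

theorem defines_univWMSO_infiniteClass (L : FirstOrder.Language.{0, 0}) :
    univWMSO.Defines (infiniteClass.{u} L) := by
  refine ⟨infinityFormula L, ?_, fun M _ _ => ?_⟩
  · exact .allSet (.ofFirstOrder (by
      simp [MSOFormula.ex, MSOFormula.neg, MSOFormula.IsFirstOrder]))
  · have h : Models univWMSO.sem M (infinityFormula L) ↔ ∀ X : Set M, X.Finite → ∃ a, a ∉ X :=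
      forall₂_congr fun X _ => MSOFormula.realize_ex
    rw [h]
    constructor
    · intro hM X hX
      exact (Set.infinite_univ_iff.2 hM).exists_notMem_finite hX |>.imp fun _ h => h.2
    · intro hM
      rw [infiniteClass, ← Set.infinite_univ_iff]
      intro hfin
      obtain ⟨a, ha⟩ := hM _ hfin
      exact ha trivial

/-! ### Dense linear orders without endpoints -/

/-- A finite partial isomorphism matches the positions, and all sets lie in its domain and
range. -/
def FiniteMatch (α β : Type*) [LinearOrder α] [LinearOrder β] (_r m n : ℕ) (V : Fin m → Set α)
    (v : Fin n → α) (W : Fin m → Set β) (w : Fin n → β) : Prop :=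
  ∃ f : Order.PartialIso α β, (∀ i, (v i, w i) ∈ f.val) ∧
    (∀ k, ∀ p ∈ f.val, p.1 ∈ V k ↔ p.2 ∈ W k) ∧
    (∀ k, ∀ a ∈ V k, ∃ b, (a, b) ∈ f.val) ∧ ∀ k, ∀ b ∈ W k, ∃ a, (a, b) ∈ f.val

/-- Density and the absence of endpoints allow extension by one point (`definedAtLeft` is cofinal);
finiteness of `X` allows iterating. -/
theorem exists_partialIso_le_of_finite {α β : Type*} [LinearOrder α] [LinearOrder β]
    [DenselyOrdered β] [NoMinOrder β] [NoMaxOrder β] [Nonempty β] (f : Order.PartialIso α β)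
    {X : Set α} (hX : X.Finite) :
    ∃ g : Order.PartialIso α β, f ≤ g ∧ ∀ a ∈ X, ∃ b, (a, b) ∈ g.val := by
  induction X, hX using Set.Finite.induction_on with
  | empty => exact ⟨f, le_rfl, fun _ h => h.elim⟩
  | @insert a X _ _ ih =>
    obtain ⟨g, hfg, hg⟩ := ih
    obtain ⟨g', hg', hgg'⟩ := (Order.PartialIso.definedAtLeft β a).isCofinal g
    refine ⟨g', hfg.trans hgg', ?_⟩
    rintro x (rfl | hx)
    · exact hg'
    · exact (hg x hx).imp fun b hb => hgg' hb

namespace FiniteMatch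

variable {α β : Type*} [LinearOrder α] [LinearOrder β] {r m n : ℕ} {V : Fin m → Set α}
  {v : Fin n → α} {W : Fin m → Set β} {w : Fin n → β}

theorem symm (h : FiniteMatch α β r m n V v W w) : FiniteMatch β α r m n W w V v := by
  obtain ⟨f, h1, h2, h3, h4⟩ := h
  have hf : ∀ a b, (b, a) ∈ f.comm.val ↔ (a, b) ∈ f.val := by
    intro a b
    simp [Order.PartialIso.comm, Subtype.map]
  refine ⟨f.comm, fun i => (hf _ _).2 (h1 i), ?_, ?_, ?_⟩
  · rintro k ⟨b, a⟩ hp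
    exact (h2 k (a, b) ((hf a b).1 hp)).symm
  · exact fun k b hb => (h4 k b hb).imp fun a ha => (hf a b).2 ha
  · exact fun k a ha => (h3 k a ha).imp fun b hb => (hf a b).2 hb

theorem eq_iff_of_mem (f : Order.PartialIso α β) {p q : α × β} (hp : p ∈ f.val) (hq : q ∈ f.val) :
    p.1 = q.1 ↔ p.2 = q.2 := by
  rw [← cmp_eq_eq_iff, f.prop p hp q hq, cmp_eq_eq_iff]

/-- A partial isomorphism that extends the given one still matches the sets. -/
theorem mem_iff_of_le {f g : Order.PartialIso α β} (hfg : f ≤ g) {A : Set α} {B : Set β}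
    (h2 : ∀ p ∈ f.val, p.1 ∈ A ↔ p.2 ∈ B) (h3 : ∀ a ∈ A, ∃ b, (a, b) ∈ f.val)
    (h4 : ∀ b ∈ B, ∃ a, (a, b) ∈ f.val) : ∀ p ∈ g.val, p.1 ∈ A ↔ p.2 ∈ B := by
  rintro ⟨a, b⟩ hp
  constructor
  · intro ha
    obtain ⟨b', hb'⟩ := h3 a ha
    obtain rfl : b = b' := (eq_iff_of_mem g hp (hfg hb')).1 rfl
    exact (h2 _ hb').1 ha
  · intro hb
    obtain ⟨a', ha'⟩ := h4 b hb
    obtain rfl : a = a' := (eq_iff_of_mem g hp (hfg ha')).2 rfl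
    exact (h2 _ ha').2 hb

variable [DenselyOrdered β] [NoMinOrder β] [NoMaxOrder β] [Nonempty β]

theorem forth (h : FiniteMatch α β (r + 1) m n V v W w) (a : α) :
    ∃ b : β, FiniteMatch α β r m (n + 1)
      V (Fin.cons (α := fun _ : Fin (n + 1) => α) a v)
      W (Fin.cons (α := fun _ : Fin (n + 1) => β) b w) := by
  obtain ⟨f, h1, h2, h3, h4⟩ := h
  obtain ⟨g, ⟨b, hb⟩, hfg⟩ := (Order.PartialIso.definedAtLeft β a).isCofinal f
  refine ⟨b, g, Fin.cases hb fun i => hfg (h1 i),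
    fun k => mem_iff_of_le hfg (h2 k) (h3 k) (h4 k),
    fun k x hx => (h3 k x hx).imp fun _ h => hfg h,
    fun k y hy => (h4 k y hy).imp fun _ h => hfg h⟩

theorem forthSet (h : FiniteMatch α β (r + 1) m n V v W w) {X : Set α} (hX : X.Finite) :
    ∃ Y : Set β, Y.Finite ∧ FiniteMatch α β r (m + 1) n
      (Fin.cons (α := fun _ : Fin (m + 1) => Set α) X V) v
      (Fin.cons (α := fun _ : Fin (m + 1) => Set β) Y W) w := by
  obtain ⟨f, h1, h2, h3, h4⟩ := h
  obtain ⟨g, hfg, hg⟩ := exists_partialIso_le_of_finite f hX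
  -- The answer is the image of `X` under the extended isomorphism `g`, finite because `g` is.
  refine ⟨{b | ∃ a ∈ X, (a, b) ∈ g.val}, ?_, g, fun i => hfg (h1 i), ?_, ?_, ?_⟩
  · refine (g.val.image Prod.snd).finite_toSet.subset ?_
    rintro b ⟨a, -, hab⟩
    exact Finset.mem_coe.2 (Finset.mem_image_of_mem Prod.snd hab)
  · refine Fin.cases ?_ fun k => mem_iff_of_le hfg (h2 k) (h3 k) (h4 k)
    rintro ⟨a, b⟩ hp
    refine ⟨fun ha => ⟨a, ha, hp⟩, ?_⟩
    rintro ⟨a', ha', hp'⟩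
    obtain rfl : a = a' := (eq_iff_of_mem g hp hp').2 rfl
    exact ha'
  · exact Fin.cases hg fun k x hx => (h3 k x hx).imp fun _ h => hfg h
  · refine Fin.cases ?_ fun k y hy => (h4 k y hy).imp fun _ h => hfg h
    rintro b ⟨a, -, hab⟩
    exact ⟨a, hab⟩

end FiniteMatch

instance : ltLanguage.IsRelational := fun _ => inferInstanceAs (IsEmpty Empty)

theorem backAndForth_finiteMatch (α β : Type*) [LinearOrder α] [LinearOrder β]
    [DenselyOrdered α] [NoMinOrder α] [NoMaxOrder α] [Nonempty α]
    [DenselyOrdered β] [NoMinOrder β] [NoMaxOrder β] [Nonempty β] :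
    BackAndForth .weak ltLanguage α β (FiniteMatch α β) where
  eq_iff := by
    rintro r m n V v W w ⟨f, h1, -⟩ i j
    exact FiniteMatch.eq_iff_of_mem f (h1 i) (h1 j)
  mem_iff := by
    rintro r m n V v W w ⟨f, h1, h2, -⟩ k i
    exact h2 k _ (h1 i)
  rel_iff := by
    rintro r m n V v W w ⟨f, h1, -⟩ k (_ | _) g
    exact lt_iff_lt_of_cmp_eq_cmp (f.prop _ (h1 (g 0)) _ (h1 (g 1)))
  forth := fun h a => h.forth a
  back := fun h b => (h.symm.forth b).imp fun _ h => h.symm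
  forthSet := fun h _ hX => h.forthSet hX
  backSet := fun h _ hY => (h.symm.forthSet hY).imp fun _ h => ⟨h.1, h.2.symm⟩

/-- Weak monadic second-order logic does not separate dense linear orders without endpoints. -/
theorem models_weak_iff_of_dense (α β : Type*) [LinearOrder α] [LinearOrder β]
    [DenselyOrdered α] [NoMinOrder α] [NoMaxOrder α] [Nonempty α]
    [DenselyOrdered β] [NoMinOrder β] [NoMaxOrder β] [Nonempty β] (φ : MSOSentence ltLanguage) :
    φ.Realize .weak (M := α) Fin.elim0 Fin.elim0 ↔ φ.Realize .weak (M := β) Fin.elim0 Fin.elim0 :=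
  (backAndForth_finiteMatch α β).realize_iff φ le_rfl
    ⟨default, fun i => i.elim0, fun i => i.elim0, fun i => i.elim0, fun i => i.elim0⟩

/-! ### The least upper bound property -/

namespace MSOFormula

/-- The variable `i` is smaller than the variable `j`. -/
def less {m n : ℕ} (i j : Fin n) : MSOFormula ltLanguage m n :=
  .rel (L := ltLanguage) LtRel.lt ![Term.var i, Term.var j]

/-- The variable `0` is an upper bound of the set variable `0`. -/
def isUpperBound (m n : ℕ) : MSOFormula ltLanguage (m + 1) (n + 1) :=
  .all (.imp (.mem 0 (Term.var 0)) (.neg (less 1 0)))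

/-- The variable `0` is a least upper bound of the set variable `0`. -/
def isLeastUpperBound (m n : ℕ) : MSOFormula ltLanguage (m + 1) (n + 1) :=
  .neg (.imp (isUpperBound m n) (.neg (.all (.imp (isUpperBound m (n + 1)) (.neg (less 0 1))))))

/-- Every nonempty set with an upper bound has a least upper bound. -/
def lubProperty : MSOSentence ltLanguage :=
  .allSet (.imp (.ex (.mem 0 (Term.var 0)))
    (.imp (.ex (isUpperBound 0 0)) (.ex (isLeastUpperBound 0 0))))

theorem isUniversal_lubProperty : lubProperty.IsUniversal :=
  .allSet (.ofFirstOrder (by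
    simp [ex, neg, isUpperBound, isLeastUpperBound, less, IsFirstOrder]))

variable {M : Type*} [LinearOrder M] {s : SetSemantics} {m n : ℕ}

/-- Only `<` is in the vocabulary; linearity turns its negation into the reversed `≤`. -/
theorem realize_isUpperBound {V : Fin (m + 1) → Set M} {v : Fin (n + 1) → M} :
    (isUpperBound m n).Realize s V v ↔ v 0 ∈ upperBounds (V 0) :=
  forall_congr' fun _ => imp_congr_right fun _ => not_lt

theorem realize_isLeastUpperBound {V : Fin (m + 1) → Set M} {v : Fin (n + 1) → M} :
    (isLeastUpperBound m n).Realize s V v ↔ IsLUB (V 0) (v 0) := by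
  have h : (isLeastUpperBound m n).Realize s V v ↔
      ¬ ((isUpperBound m n).Realize s V v → ¬ ∀ a : M,
        (isUpperBound m (n + 1)).Realize s V
          (Fin.cons (α := fun _ : Fin (n + 1 + 1) => M) a v) → ¬ a < v 0) := Iff.rfl
  simp only [h, realize_isUpperBound, Fin.cons_zero, not_lt, Classical.not_imp, not_not]
  exact Iff.rfl

theorem models_lubProperty_iff (M : Type u) [LinearOrder M] :
    Models .full M lubProperty ↔
      ∀ X : Set M, X.Nonempty → BddAbove X → ∃ b, IsLUB X b := by
  refine forall_congr' fun X => ?_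
  rw [forall_prop_of_true (show SetSemantics.full.Admits X from trivial)]
  refine imp_congr realize_ex (imp_congr ?_ ?_)
  · exact realize_ex.trans (exists_congr fun b => realize_isUpperBound)
  · exact realize_ex.trans (exists_congr fun b => realize_isLeastUpperBound)

end MSOFormula

/-- The rationals below √2 have no rational supremum: a candidate differs from √2, and a rational
strictly between the two refutes it. -/
theorem not_forall_exists_isLUB_rat :
    ¬ ∀ X : Set ℚ, X.Nonempty → BddAbove X → ∃ b, IsLUB X b := by
  intro h
  have h2 : √2 < 2 := by
    rw [Real.sqrt_lt' two_pos]
    norm_num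
  obtain ⟨b, hub, hlub⟩ := h {q | (q : ℝ) < √2} ⟨1, by simpa using Real.one_lt_sqrt_two⟩
    ⟨2, fun q hq => (Rat.cast_lt.1 (lt_trans hq (by simp [h2]) : (q : ℝ) < (2 : ℚ))).le⟩
  rcases lt_trichotomy (b : ℝ) √2 with hb | hb | hb
  · obtain ⟨q, hbq, hq⟩ := exists_rat_btwn hb
    exact absurd (Rat.cast_lt.1 hbq) (not_lt_of_ge (hub hq))
  · exact irrational_sqrt_two ⟨b, hb⟩
  · obtain ⟨q, hq, hqb⟩ := exists_rat_btwn hb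
    exact absurd (Rat.cast_lt.1 hqb) (not_lt_of_ge (hlub fun p hp =>
      (Rat.cast_lt.1 (lt_trans hp hq : (p : ℝ) < q)).le))

/-- Used to move completeness to and from `ULift`, since `MonadicLogic.Le` speaks of structures in
an arbitrary universe while ℝ and ℚ live in the lowest one. -/
theorem exists_isLUB_of_orderIso {α β : Type*} [Preorder α] [Preorder β] (e : α ≃o β)
    (h : ∀ X : Set α, X.Nonempty → BddAbove X → ∃ b, IsLUB X b) :
    ∀ X : Set β, X.Nonempty → BddAbove X → ∃ b, IsLUB X b := by
  intro X hX hb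
  obtain ⟨b, hb⟩ := h (e.symm '' X) (hX.image _) (e.symm.monotone.map_bddAbove hb)
  exact ⟨e b, by simpa [Set.image_image] using e.isLUB_image'.2 hb⟩

instance {α : Type*} [Preorder α] [DenselyOrdered α] : DenselyOrdered (ULift.{u} α) :=
  (denselyOrdered_iff_of_orderIsoClass (ULift.orderIso : ULift.{u} α ≃o α)).2 ‹_›

instance {α : Type*} [Preorder α] [NoMinOrder α] : NoMinOrder (ULift.{u} α) :=
  ⟨fun a => (exists_lt a.down).elim fun b hb => ⟨⟨b⟩, hb⟩⟩

instance {α : Type*} [Preorder α] [NoMaxOrder α] : NoMaxOrder (ULift.{u} α) :=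
  ⟨fun a => (exists_gt a.down).elim fun b hb => ⟨⟨b⟩, hb⟩⟩

theorem not_le_univMSO_wmso : ¬ MonadicLogic.Le.{u} univMSO WMSO := by
  intro h
  obtain ⟨ψ, -, hψ⟩ := h ltLanguage
    (fun M _ => Models .full M MSOFormula.lubProperty)
    ⟨MSOFormula.lubProperty, MSOFormula.isUniversal_lubProperty, fun M _ _ => Iff.rfl⟩
  have h1 := (hψ (ULift.{u} ℝ)).1 ((MSOFormula.models_lubProperty_iff _).2
    (exists_isLUB_of_orderIso ULift.orderIso.symm fun _ => Real.exists_isLUB))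
  have h2 := (hψ (ULift.{u} ℚ)).2 ((models_weak_iff_of_dense _ _ ψ).1 h1)
  exact not_forall_exists_isLUB_rat (exists_isLUB_of_orderIso ULift.orderIso
    ((MSOFormula.models_lubProperty_iff _).1 h2))

theorem not_le_univWMSO_mso : ¬ MonadicLogic.Le.{u} univWMSO MSO := fun h =>
  not_defines_mso_infiniteClass ltLanguage (h _ _ (defines_univWMSO_infiniteClass ltLanguage))

end MonadicSO

theorem mainTheorem7 :
    -- the two non-inclusions
    ¬ MonadicLogic.Le.{u} univWMSO MSO ∧
    ¬ MonadicLogic.Le.{u} univMSO WMSO ∧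
    -- infinity, over every relational vocabulary
    (∀ (L : FirstOrder.Language.{0, 0}) [L.IsRelational],
      univWMSO.Defines (infiniteClass.{u} L) ∧ ¬ MSO.Defines (infiniteClass.{u} L)) ∧
    -- the least upper bound property, and its failure to be preserved from the reals to the rationals
    (∃ φ ∈ univMSO.sentences ltLanguage,
      (∀ (M : Type u) [Nonempty M] [LinearOrder M],
        Models univMSO.sem M φ ↔
          ∀ X : Set M, X.Nonempty → BddAbove X → ∃ b, IsLUB X b) ∧
      Models univMSO.sem ℝ φ ∧ ¬ Models univMSO.sem ℚ φ) ∧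
    -- no sentence of weak monadic second-order logic separates the reals from the rationals
    (∀ φ ∈ WMSO.sentences ltLanguage, Models WMSO.sem ℝ φ ↔ Models WMSO.sem ℚ φ) := by
  refine ⟨not_le_univWMSO_mso, not_le_univMSO_wmso,
    fun L _ => ⟨defines_univWMSO_infiniteClass L, not_defines_mso_infiniteClass L⟩,
    ⟨MSOFormula.lubProperty, MSOFormula.isUniversal_lubProperty,
      fun M _ _ => MSOFormula.models_lubProperty_iff M, ?_, ?_⟩,
    fun φ _ => models_weak_iff_of_dense ℝ ℚ φ⟩
  · exact (MSOFormula.models_lubProperty_iff ℝ).2 fun _ => Real.exists_isLUB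
  · exact fun h => not_forall_exists_isLUB_rat ((MSOFormula.models_lubProperty_iff ℚ).1 h)
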